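/- **Model.** Let $0\le q\le\frac12$, $p=1-q$, $\gamma\in[0,1]$, and let $n_1\ge 3$ be an integer. Blocks are mined independently, each by the selfish miner (S) with probability $q$ and by the honest miners (H) with probability $p$. An attack cycle is one of the words H, SHS, SHH, or a word starting with SS that stops at the first time when the advance $\#S-\#H$ falls to $1$. In SHH the last block is mined on top of the selfish block with probability $\gamma$ and on top of the first honest block with probability $1-\gamma$. In each cycle the selfish miner and the honest miners build two branches on the last official block preceding the cycle (the selfish fork is kept secret until the end of the cycle, "brutal fork"). The longer branch becomes official. An *uncle* is an orphan block whose parent is official. Let $(\omega_i)_{i\in\mathbb Z}$ be independent attack cycles with this law, each one starting on the last official block of the preceding one. The selfish miner refers to no uncle. An uncle can only be referred by the first honest official block whose height is larger than its own, and only if the distance (difference of the heights) is at most $n_1$. Each honest official block refers to all uncles available to it in this sense, but to at most two of them, the most recent ones first. An uncle that is not referred in this way is never referred. For a cycle $\omega$ let $U(\omega)$ be the number of uncles created in $\omega$ that are referred (in $\omega$ or in a later cycle), and $U'(\omega)$ the number of uncles referred by blocks of $\omega$. **Notation.** Let $C_k=\frac{(2k)!}{k!(k+1)!}$, $C_n(x)=\sum_{k=0}^n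 C_kx^k$, $\pi_0=\pi_1=0$, and $\pi_k=pq^2\bigl(\mathbf 1_{k=2}+(pq)^{k-2}C_{k-2}\bigr)$ for $k\ge2$. **Theorem.** (i) Conditionally on $\omega=\mathrm{H}$, $$\mathbb P[U'=1\mid \omega=\mathrm H]=\sum_{i=2}^{n_1-2}\bigl(1-pq^2-pq^2C_{n_1-2-i}(pq)\bigr)\pi_i+\pi_{n_1-1}+\pi_{n_1},$$ $$\mathbb P[U'=2\mid \omega=\mathrm H]=\sum_{i,j\ge 0,\ i+j\le n_1}\pi_i\pi_j,\qquad \mathbb P[U'\ge3\mid \omega=\mathrm H]=0,$$ so that $P_{n_1}(p,q):=\mathbb E[U'\mid\omega=\mathrm H]=\mathbb P[U'=1\mid \omega=\mathrm H]+2\,\mathbb P[U'=2\mid \omega=\mathrm H]$. (ii) The variable $U$ is integrable and $$\mathbb E[U]=\bigl(p+(1-\gamma)p^2q\bigr)P_{n_1}(p,q)+\gamma p^2q\bigl(pq^2+pq^2C_{n_1-3}(pq)\bigr)+p^2q .$$ -/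

import Mathlib

namespace BrutalFork

/-- Who mined a block: the selfish miner `S` or the honest miners `H`. -/
inductive Miner
  | S
  | H
  deriving DecidableEq

open Miner

/-- The advance of the selfish miner over the honest miners after the blocks of `w`. -/
def advance (w : List Miner) : ℤ := (w.count S : ℤ) - (w.count H : ℤ)

/-- Chronological words of attack cycles: `H`; a competition `SHS` or `SHH`; or a word that starts
with `SS` and stops at the first moment when the advance of the selfish miner falls to `1`. -/
def IsCycleWord (ω : List Miner) : Prop :=
  ω = [H] ∨ ω = [S, H, S] ∨ ω = [S, H, H] ∨
    ∃ w, ω = S :: S :: w ∧ advance ω = 1 ∧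
      ∀ v, v <+: w → v ≠ w → 2 ≤ advance (S :: S :: v)

/-- An attack cycle: its word and, for `SHH` only, whether the last honest block was mined on top of
the selfish block (`onSelfish = true`) or on top of the first honest block. -/
structure Cycle where
  word : List Miner
  onSelfish : Bool
  isCycleWord : IsCycleWord word
  eq_of_onSelfish : onSelfish = true → word = [S, H, H]

/-- Cycles form a countable set, considered with its discrete σ-algebra. -/
instance : MeasurableSpace Cycle := ⊤

/-- The probability of a cycle: independent blocks, honest with probability `p` and selfish with
probability `q`; in `SHH` the last block goes on top of the selfish one with probability `γ`. -/
noncomputable def Cycle.weight (p q γ : ℝ) (c : Cycle) : ℝ :=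
  p ^ c.word.count H * q ^ c.word.count S *
    (if c.word = [S, H, H] then (if c.onSelfish then γ else 1 - γ) else 1)

/-- Owners of the blocks of the branch started by the selfish miner, by increasing height.
The fork is secret until the end of the cycle, so no other honest block can be mined on it. -/
def Cycle.selfishBranch (c : Cycle) : List Miner :=
  List.replicate (c.word.count S) S ++ (if c.onSelfish then [H] else [])

/-- Owners of the blocks of the branch started by the honest miners, by increasing height. -/
def Cycle.honestBranch (c : Cycle) : List Miner :=
  List.replicate (c.word.count H - (if c.onSelfish then 1 else 0)) H

/-- The official blocks of the cycle: the longer one of the two branches. -/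
def Cycle.official (c : Cycle) : List Miner :=
  if c.selfishBranch.length < c.honestBranch.length then c.honestBranch else c.selfishBranch

/-- The orphan blocks of the cycle: the shorter one of the two branches. -/
def Cycle.orphans (c : Cycle) : List Miner :=
  if c.selfishBranch.length < c.honestBranch.length then c.selfishBranch else c.honestBranch

/-- The number `L` of official blocks that the cycle adds. -/
def Cycle.len (c : Cycle) : ℕ := c.official.length

/-- The cycle creates an uncle, an orphan block whose parent is official. Both branches start on
the last official block before the cycle, so only the first orphan block has an official parent. -/
def Cycle.HasUncle (c : Cycle) : Prop := c.orphans ≠ []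

/-- Height of the last official block before cycle `i`, when the one before cycle `0` has
height `0`. -/
noncomputable def baseHeight (c : ℤ → Cycle) (i : ℤ) : ℤ :=
  ∑ j ∈ Finset.Ico 0 i, ((c j).len : ℤ) - ∑ j ∈ Finset.Ico i 0, ((c j).len : ℤ)

/-- The `k`-th official block of cycle `i` (counted from `0`) exists and is honest. -/
def IsHonestBlock (c : ℤ → Cycle) (i : ℤ) (k : ℕ) : Prop := (c i).official[k]? = some H

/-- Height of the `k`-th official block of cycle `i`. -/
noncomputable def blockHeight (c : ℤ → Cycle) (i : ℤ) (k : ℕ) : ℤ := baseHeight c i + k + 1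

/-- Height of the uncle created in cycle `j`. -/
noncomputable def uncleHeight (c : ℤ → Cycle) (j : ℤ) : ℤ := baseHeight c j + 1

/-- The uncle of cycle `j` can be referred by the `k`-th official block of cycle `i`: that block is
the first honest official block above the uncle, and it is at a distance at most `n₁`. (An uncle is
referred at this first opportunity or never.) -/
def CanRefer (n₁ : ℕ) (c : ℤ → Cycle) (j i : ℤ) (k : ℕ) : Prop :=
  (c j).HasUncle ∧ IsHonestBlock c i k ∧ uncleHeight c j < blockHeight c i k ∧
    (∀ i' k', IsHonestBlock c i' k' → uncleHeight c j < blockHeight c i' k' →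
      blockHeight c i k ≤ blockHeight c i' k') ∧
    blockHeight c i k - uncleHeight c j ≤ n₁

/-- The `k`-th official block of cycle `i` refers the uncle of cycle `j`: a block refers at most
two uncles, the most recent ones first. -/
def Refers (n₁ : ℕ) (c : ℤ → Cycle) (j i : ℤ) (k : ℕ) : Prop :=
  CanRefer n₁ c j i k ∧ {j' | j < j' ∧ CanRefer n₁ c j' i k}.encard < 2

/-- `U`: the number of uncles created in cycle `m` that are referred, in that cycle or later. -/
noncomputable def U (n₁ : ℕ) (c : ℤ → Cycle) (m : ℤ) : ℕ :=
  {j | j = m ∧ ∃ i k, Refers n₁ c j i k}.ncard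

/-- `U'`: the number of uncles that are referred by blocks of cycle `m`. -/
noncomputable def U' (n₁ : ℕ) (c : ℤ → Cycle) (m : ℤ) : ℕ :=
  {j | ∃ k, Refers n₁ c j m k}.ncard

/-- The partial sum `∑_{k ≤ n} C_k x ^ k` of the generating series of the Catalan numbers. -/
noncomputable def catalanSum (n : ℕ) (x : ℝ) : ℝ :=
  ∑ k ∈ Finset.range (n + 1), (catalan k : ℝ) * x ^ k

/-- The numbers `π_k`. -/
noncomputable def piSeq (p q : ℝ) (k : ℕ) : ℝ :=
  if 2 ≤ k then
    p * q ^ 2 * ((if k = 2 then 1 else 0) + (p * q) ^ (k - 2) * (catalan (k - 2) : ℝ))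
  else 0

/-- The closed form for the probability of `U' = 1` given the cycle `H`. -/
noncomputable def probOne (n₁ : ℕ) (p q : ℝ) : ℝ :=
  ∑ i ∈ Finset.Icc 2 (n₁ - 2),
      (1 - p * q ^ 2 - p * q ^ 2 * catalanSum (n₁ - 2 - i) (p * q)) * piSeq p q i +
    piSeq p q (n₁ - 1) + piSeq p q n₁

/-- The closed form for the probability of `U' = 2` given the cycle `H`. -/
noncomputable def probTwo (n₁ : ℕ) (p q : ℝ) : ℝ :=
  ∑ ij ∈ Finset.range (n₁ + 1) ×ˢ Finset.range (n₁ + 1) with ij.1 + ij.2 ≤ n₁,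
    piSeq p q ij.1 * piSeq p q ij.2

/-- The closed form for `P_{n₁}(p, q)`, the expectation of `U'` given the cycle `H`. -/
noncomputable def meanH (n₁ : ℕ) (p q : ℝ) : ℝ := probOne n₁ p q + 2 * probTwo n₁ p q

end BrutalFork

open MeasureTheory ProbabilityTheory BrutalFork

namespace BrutalFork

open Miner

/-! Every cycle is H, SHH (in two variants), SHS, or SS followed by a Dyck word and H
(`Cycle.cases`). All official blocks are selfish exactly for SHS and the SS-words. Those of official
length `k` have total probability `piSeq p q k`, because Catalan numbers count Dyck words
(`measureReal_preimage_selfishOfLen`).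

The uncle of an SHH is referred at once. The uncle of a selfish cycle waits through further selfish
cycles for the first honest official block (`canRefer_of_lt`), and the cap of two keeps only the two
most recent candidates (`refers_of_lt`). Hence three consecutive cycles decide whether an uncle is
referred (`exists_refers_iff`).

Given H at cycle `m`, `U'` is the sum of the indicators of two events: A, the previous cycle is
selfish of length at most `n₁`; and B ⊆ A, the two previous cycles are selfish of total length at
most `n₁`. By independence P(A) is a partial sum of `piSeq` and P(B) is `probTwo`. The identity
`probOne_add_probTwo` turns P(A) - P(B) into `probOne`, and the mean is P(A) + P(B). Likewise `U` is
the indicator of a disjoint union of four events, whose probabilities add up to the formula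
(`measureReal_exists_refers`). -/

/-! ### Classification of cycles by Dyck words -/

/-- Up-steps are selfish blocks and down-steps are honest blocks. -/
def ofStep : DyckStep ≃ Miner where
  toFun | .U => S | .D => H
  invFun | S => .U | H => .D
  left_inv s := by cases s <;> rfl
  right_inv s := by cases s <;> rfl

theorem count_S_map_ofStep (l : List DyckStep) : (l.map ofStep).count S = l.count .U :=
  List.count_map_of_injective l ofStep ofStep.injective .U

theorem count_H_map_ofStep (l : List DyckStep) : (l.map ofStep).count H = l.count .D :=
  List.count_map_of_injective l ofStep ofStep.injective .D

theorem Cycle.ext_word {c c' : Cycle} (hw : c.word = c'.word)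
    (hs : c.onSelfish = c'.onSelfish) : c = c' := by
  cases c; cases c'; simp_all

/-- The cycle `H`. -/
def cycleH : Cycle := ⟨[H], false, Or.inl rfl, by simp⟩

/-- The cycle `SHS`. -/
def cycleSHS : Cycle := ⟨[S, H, S], false, Or.inr (Or.inl rfl), by simp⟩

/-- The cycle `SHH`, with the position of the last block. -/
def cycleSHH (b : Bool) : Cycle := ⟨[S, H, H], b, Or.inr (Or.inr (Or.inl rfl)), fun _ => rfl⟩

/-- The cycle whose word is `SS`, then a Dyck word, then `H`. -/
def cycleSS (d : DyckWord) : Cycle where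
  word := S :: S :: (d.toList.map ofStep ++ [H])
  onSelfish := false
  eq_of_onSelfish := by simp
  isCycleWord := by
    refine Or.inr (Or.inr (Or.inr ⟨_, rfl, ?_, fun v hv hne => ?_⟩))
    · simp [advance, count_S_map_ofStep, count_H_map_ofStep, d.count_U_eq_count_D]
    -- A proper prefix lies inside the Dyck word, where up-steps dominate; the initial SS lifts the
    -- advance to at least 2.
    · rcases List.prefix_concat_iff.mp (by simpa using hv) with h | h
      · exact absurd h hne
      · rw [List.prefix_iff_eq_take, ← List.map_take] at h
        have := d.count_D_le_count_U v.length
        rw [h]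
        simp only [advance, List.count_cons, count_S_map_ofStep, count_H_map_ofStep]
        simp
        omega

/-- The advance is at least 2 just before the end and equals 1 at the end, so the last letter is H
and the advance before it is exactly 2. Without SS and this H, the prefix condition is Dyck
nonnegativity and the advance 2 is balance. -/
theorem exists_dyckWord_of_prefix {w : List Miner} (h1 : advance (S :: S :: w) = 1)
    (h2 : ∀ v, v <+: w → v ≠ w → 2 ≤ advance (S :: S :: v)) :
    ∃ d : DyckWord, w = d.toList.map ofStep ++ [H] := by
  rcases List.eq_nil_or_concat' w with rfl | ⟨w', x, rfl⟩
  · simp [advance] at h1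
  have h3 := h2 w' (List.prefix_append _ _) (by simp)
  obtain rfl : x = H := by
    cases x
    · simp [advance] at h1 h3
      omega
    · rfl
  have hm : w' = (w'.map ofStep.symm).map ofStep := by simp
  have hc (l : List Miner) : (l.map ofStep.symm).count .U = l.count S ∧
      (l.map ofStep.symm).count .D = l.count H := by
    rw [← count_S_map_ofStep, ← count_H_map_ofStep]; simp
  refine ⟨⟨w'.map ofStep.symm, ?_, fun i => ?_⟩, by simp⟩
  · rw [(hc w').1, (hc w').2]
    simp [advance] at h1 h3
    omega
  · rw [← List.map_take, (hc _).1, (hc _).2]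
    have h4 := h2 (w'.take i) ((List.take_prefix i w').trans (List.prefix_append _ _)) (by
      intro h
      have := congrArg List.length h
      simp at this
      omega)
    simp [advance] at h4
    omega

theorem Cycle.cases (c : Cycle) :
    c = cycleH ∨ (∃ b, c = cycleSHH b) ∨ c = cycleSHS ∨ ∃ d, c = cycleSS d := by
  have hon (h : c.word ≠ [S, H, H]) : c.onSelfish = false :=
    Bool.eq_false_iff.mpr fun h' => h (c.eq_of_onSelfish h')
  rcases c.isCycleWord with h | h | h | ⟨w, h, h1, h2⟩
  · exact Or.inl (Cycle.ext_word h (hon (by simp [h])))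
  · exact Or.inr (Or.inr (Or.inl (Cycle.ext_word h (hon (by simp [h])))))
  · exact Or.inr (Or.inl ⟨c.onSelfish, Cycle.ext_word h rfl⟩)
  · obtain ⟨d, rfl⟩ := exists_dyckWord_of_prefix (h ▸ h1) h2
    exact Or.inr (Or.inr (Or.inr ⟨d, Cycle.ext_word h (hon (by simp [h]))⟩))

theorem cycleSS_injective : Function.Injective cycleSS := by
  intro d d' h
  have := congrArg Cycle.word h
  simp only [cycleSS, List.cons.injEq, true_and, List.append_cancel_right_eq] at this
  exact DyckWord.ext (ofStep.injective.list_map this)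

theorem cycleSS_count_S (d : DyckWord) : (cycleSS d).word.count S = d.semilength + 2 := by
  simp [cycleSS, count_S_map_ofStep, DyckWord.semilength]

theorem cycleSS_count_H (d : DyckWord) : (cycleSS d).word.count H = d.semilength + 1 := by
  simp [cycleSS, count_H_map_ofStep, d.semilength_eq_count_D]

theorem cycleSS_word_ne (d : DyckWord) : (cycleSS d).word ≠ [S, H, H] := by
  simp [cycleSS]

theorem official_cycleH : cycleH.official = [H] := by decide
theorem official_cycleSHS : cycleSHS.official = [S, S] := by decide
theorem official_cycleSHH_true : (cycleSHH true).official = [S, H] := by decide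
theorem official_cycleSHH_false : (cycleSHH false).official = [H, H] := by decide

theorem selfishBranch_cycleSS (d : DyckWord) :
    (cycleSS d).selfishBranch = List.replicate (d.semilength + 2) S := by
  simp [Cycle.selfishBranch, cycleSS_count_S, show (cycleSS d).onSelfish = false from rfl]

theorem honestBranch_cycleSS (d : DyckWord) :
    (cycleSS d).honestBranch = List.replicate (d.semilength + 1) H := by
  simp [Cycle.honestBranch, cycleSS_count_H, show (cycleSS d).onSelfish = false from rfl]

theorem official_cycleSS (d : DyckWord) :
    (cycleSS d).official = List.replicate (d.semilength + 2) S := by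
  rw [Cycle.official, selfishBranch_cycleSS, honestBranch_cycleSS]
  simp

theorem hasUncle_cycleSS (d : DyckWord) : (cycleSS d).HasUncle := by
  rw [Cycle.HasUncle, Cycle.orphans, selfishBranch_cycleSS, honestBranch_cycleSS]
  simp [List.replicate_succ]

theorem not_hasUncle_cycleH : ¬ cycleH.HasUncle := not_not.mpr (by decide)
theorem hasUncle_cycleSHS : cycleSHS.HasUncle := show _ ≠ _ by decide
theorem hasUncle_cycleSHH (b : Bool) : (cycleSHH b).HasUncle := by
  cases b <;> exact show _ ≠ _ by decide

/-! ### Cycles with only selfish official blocks, and their probabilities -/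

/-- All the official blocks of the cycle are selfish. -/
def Cycle.IsSelfish (c : Cycle) : Prop := H ∉ c.official

theorem isSelfish_iff {c : Cycle} :
    c.IsSelfish ↔ c = cycleSHS ∨ ∃ d, c = cycleSS d := by
  constructor
  · intro h
    rcases c.cases with rfl | ⟨b, rfl⟩ | h | h
    · simp [Cycle.IsSelfish, official_cycleH] at h
    · cases b <;> simp [Cycle.IsSelfish, official_cycleSHH_true, official_cycleSHH_false] at h
    · exact Or.inl h
    · exact Or.inr h
  · rintro (rfl | ⟨d, rfl⟩)
    · simp [Cycle.IsSelfish, official_cycleSHS]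
    · simp [Cycle.IsSelfish, official_cycleSS]

theorem Cycle.IsSelfish.hasUncle {c : Cycle} (h : c.IsSelfish) : c.HasUncle := by
  rcases isSelfish_iff.mp h with rfl | ⟨d, rfl⟩
  exacts [hasUncle_cycleSHS, hasUncle_cycleSS d]

theorem Cycle.IsSelfish.two_le_len {c : Cycle} (h : c.IsSelfish) : 2 ≤ c.len := by
  rcases isSelfish_iff.mp h with rfl | ⟨d, rfl⟩
  · simp [Cycle.len, official_cycleSHS]
  · simp [Cycle.len, official_cycleSS]

theorem Cycle.len_pos (c : Cycle) : 0 < c.len := by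
  rcases c.cases with rfl | ⟨b, rfl⟩ | h | h
  · simp [Cycle.len, official_cycleH]
  · cases b <;> simp [Cycle.len, official_cycleSHH_true, official_cycleSHH_false]
  all_goals have := (isSelfish_iff.mpr (by tauto) : c.IsSelfish).two_le_len; omega

/-- The cycles whose `k` official blocks are all selfish. -/
def selfishOfLen (k : ℕ) : Set Cycle := {c | c.IsSelfish ∧ c.len = k}

-- A Dyck word of semilength `n` yields official length `n + 2`; SHS is the one extra cycle of
-- length 2. Writing the set as a finite set makes its probability a finite sum of weights.
open Classical in
theorem selfishOfLen_add_two (n : ℕ) : selfishOfLen (n + 2) =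
    ((if n = 0 then {cycleSHS} else ∅) ∪ Finset.univ.image
      (fun d : {d : DyckWord // d.semilength = n} => cycleSS d) : Finset Cycle) := by
  ext c
  simp only [selfishOfLen, isSelfish_iff, Set.mem_ofPred_eq, Finset.coe_union, Set.mem_union,
    Finset.mem_coe, Finset.mem_image, Finset.mem_univ, true_and, Subtype.exists]
  constructor
  · rintro ⟨rfl | ⟨d, rfl⟩, h⟩
    · left
      simp [Cycle.len, official_cycleSHS] at h
      simp [h]
    · right
      simp [Cycle.len, official_cycleSS] at h
      exact ⟨d, h, rfl⟩
  · rintro (h | ⟨d, hd, rfl⟩)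
    · split_ifs at h with h0
      · simp at h
        subst h h0
        simp [Cycle.len, official_cycleSHS]
      · simp at h
    · simp [Cycle.len, official_cycleSS, hd]

theorem weight_cycleSS (p q γ : ℝ) (d : DyckWord) :
    (cycleSS d).weight p q γ = p * q ^ 2 * (p * q) ^ d.semilength := by
  rw [Cycle.weight, cycleSS_count_S, cycleSS_count_H, if_neg (cycleSS_word_ne d)]
  ring

theorem weight_cycleH (p q γ : ℝ) : cycleH.weight p q γ = p := by
  simp [Cycle.weight, cycleH]

theorem weight_cycleSHS (p q γ : ℝ) : cycleSHS.weight p q γ = p * q ^ 2 := by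
  simp [Cycle.weight, cycleSHS]

theorem weight_cycleSHH (p q γ : ℝ) (b : Bool) :
    (cycleSHH b).weight p q γ = p ^ 2 * q * if b then γ else 1 - γ := by
  cases b <;> simp [Cycle.weight, cycleSHH]

variable {Ω : Type*} [MeasurableSpace Ω] {μ : Measure Ω} [IsProbabilityMeasure μ]

/-- Dyck words of equal semilength give cycles of equal weight, hence the Catalan factor. The
indicator of `k = 2` in `piSeq` is the contribution of SHS. -/
theorem measureReal_preimage_selfishOfLen {p q γ : ℝ} {X : Ω → Cycle} (hX : Measurable X)
    (hlaw : ∀ c, μ.real {x | X x = c} = c.weight p q γ) (k : ℕ) :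
    μ.real (X ⁻¹' selfishOfLen k) = piSeq p q k := by
  classical
  rcases Nat.lt_or_ge k 2 with hk | hk
  · have : selfishOfLen k = ∅ :=
      Set.eq_empty_of_forall_notMem fun c hc => by have := hc.1.two_le_len; have := hc.2; omega
    simp [this, piSeq, hk]
  obtain ⟨n, rfl⟩ := Nat.exists_eq_add_of_le' hk
  rw [selfishOfLen_add_two, ← sum_measureReal_preimage_singleton _
    (fun c _ => hX (MeasurableSpace.measurableSet_top))]
  have hw (c : Cycle) : μ.real (X ⁻¹' {c}) = c.weight p q γ := hlaw c
  simp only [hw]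
  rw [Finset.sum_union, Finset.sum_image]
  · have h (d : {d : DyckWord // d.semilength = n}) :
        (cycleSS d).weight p q γ = p * q ^ 2 * (p * q) ^ n := by
      rw [weight_cycleSS, d.2]
    simp only [h, Finset.sum_const, Finset.card_univ,
      DyckWord.card_dyckWord_semilength_eq_catalan, nsmul_eq_mul]
    rcases eq_or_ne n 0 with rfl | hn
    · simp [piSeq, weight_cycleSHS]; ring
    · simp [piSeq, hn]; ring
  · exact fun d _ d' _ h => Subtype.ext (cycleSS_injective h)
  · rw [Finset.disjoint_left]
    intro c hc hc'
    split_ifs at hc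
    · simp only [Finset.mem_singleton, Finset.mem_image] at hc hc'
      obtain ⟨d, -, h⟩ := hc'
      have := congrArg Cycle.word (h.trans hc)
      simp [cycleSS, cycleSHS] at this
    · simp at hc

/-! ### First honest official block, and heights -/

theorem Cycle.cases_of_not_isSelfish {c : Cycle} (h : ¬ c.IsSelfish) :
    c = cycleH ∨ ∃ b, c = cycleSHH b := by
  rw [isSelfish_iff] at h
  have := c.cases
  tauto

/-- The first official block of the cycle is honest. -/
def Cycle.StartsHonest (c : Cycle) : Prop := c = cycleH ∨ c = cycleSHH false

/-- The first honest official block of the cycle has index `k`. -/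
def Cycle.FirstHonest (c : Cycle) (k : ℕ) : Prop :=
  c.official[k]? = some H ∧ ∀ k', c.official[k']? = some H → k ≤ k'

theorem Cycle.IsSelfish.getElem?_ne {c : Cycle} (h : c.IsSelfish) (k : ℕ) :
    c.official[k]? ≠ some H := fun h' => h (List.mem_of_getElem? h')

theorem firstHonest_iff {c : Cycle} {k : ℕ} :
    c.FirstHonest k ↔ (k = 0 ∧ c.StartsHonest) ∨ (k = 1 ∧ c = cycleSHH true) := by
  have hne : cycleSHH true ≠ cycleH := fun h => by simpa [cycleSHH, cycleH] using congrArg Cycle.word h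
  have hne' : cycleSHH true ≠ cycleSHH false :=
    fun h => by simpa [cycleSHH] using congrArg Cycle.onSelfish h
  by_cases hs : c.IsSelfish
  · have h1 : c ≠ cycleH := by rintro rfl; simp [Cycle.IsSelfish, official_cycleH] at hs
    have h2 (b) : c ≠ cycleSHH b := by
      rintro rfl
      cases b <;> simp [Cycle.IsSelfish, official_cycleSHH_true, official_cycleSHH_false] at hs
    simp [Cycle.FirstHonest, hs.getElem?_ne, Cycle.StartsHonest, h1, h2]
  rcases Cycle.cases_of_not_isSelfish hs with rfl | ⟨_ | _, rfl⟩
  · constructor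
    · rintro ⟨-, h⟩
      have := h 0 (by simp [official_cycleH])
      exact Or.inl ⟨by omega, Or.inl rfl⟩
    · rintro (⟨rfl, -⟩ | ⟨-, h⟩)
      · exact ⟨by simp [official_cycleH], fun _ _ => Nat.zero_le _⟩
      · exact absurd h.symm hne
  · constructor
    · rintro ⟨-, h⟩
      have := h 0 (by simp [official_cycleSHH_false])
      exact Or.inl ⟨by omega, Or.inr rfl⟩
    · rintro (⟨rfl, -⟩ | ⟨-, h⟩)
      · exact ⟨by simp [official_cycleSHH_false], fun _ _ => Nat.zero_le _⟩
      · exact absurd h.symm hne'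
  · constructor
    · rintro ⟨h0, h⟩
      have := h 1 (by simp [official_cycleSHH_true])
      refine Or.inr ⟨?_, rfl⟩
      rcases Nat.eq_zero_or_pos k with rfl | hk
      · simp [official_cycleSHH_true] at h0
      · omega
    · rintro (⟨-, h | h⟩ | ⟨rfl, -⟩)
      · exact absurd h hne
      · exact absurd h hne'
      · refine ⟨by simp [official_cycleSHH_true], fun k' hk' => ?_⟩
        rcases Nat.eq_zero_or_pos k' with rfl | hk
        · simp [official_cycleSHH_true] at hk'
        · omega

theorem baseHeight_succ (c : ℤ → Cycle) (i : ℤ) :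
    baseHeight c (i + 1) = baseHeight c i + (c i).len := by
  unfold baseHeight
  rcases le_or_gt 0 i with h | h
  · rw [Finset.Ico_eq_empty (a := i + 1) (by omega), Finset.Ico_eq_empty (a := i) (by omega),
      show Finset.Ico 0 (i + 1) = insert i (Finset.Ico 0 i) by ext; simp; omega,
      Finset.sum_insert (by simp)]
    simp only [Finset.sum_empty]
    ring
  · rw [Finset.Ico_eq_empty (a := 0) (b := i + 1) (by omega),
      Finset.Ico_eq_empty (a := 0) (b := i) (by omega),
      show Finset.Ico i 0 = insert i (Finset.Ico (i + 1) 0) by ext; simp; omega,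
      Finset.sum_insert (by simp)]
    simp only [Finset.sum_empty]
    ring

theorem baseHeight_strictMono (c : ℤ → Cycle) : StrictMono (baseHeight c) :=
  strictMono_int_of_lt_succ fun i => by
    rw [baseHeight_succ]
    have := (c i).len_pos
    omega

/-! ### Which block refers which uncle -/

section Refers

variable {n₁ : ℕ} {c : ℤ → Cycle} {i j : ℤ} {k : ℕ}

theorem IsHonestBlock.blockHeight_le (h : IsHonestBlock c i k) :
    blockHeight c i k ≤ baseHeight c (i + 1) := by
  have : k < (c i).len := (List.getElem?_eq_some_iff.mp h).1
  rw [baseHeight_succ, blockHeight]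
  omega

theorem CanRefer.le (h : CanRefer n₁ c j i k) : j ≤ i := by
  obtain ⟨-, hb, hlt, -⟩ := h
  by_contra! hij
  have h1 := hb.blockHeight_le
  have h2 := (baseHeight_strictMono c).monotone (by omega : i + 1 ≤ j)
  rw [uncleHeight] at hlt
  omega

/-- Any non-selfish cycle from `j` up to `i - 1` would already contain an honest block above the
uncle, so only selfish cycles can be crossed. -/
theorem canRefer_of_lt (hij : j < i) : CanRefer n₁ c j i k ↔
    (∀ l, j ≤ l → l < i → (c l).IsSelfish) ∧ (c i).FirstHonest k ∧
      baseHeight c i - baseHeight c j + k ≤ n₁ := by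
  have hmono := (baseHeight_strictMono c).monotone
  have hsm := baseHeight_strictMono c hij
  constructor
  · rintro ⟨hu, hb, hlt, hfirst, hd⟩
    simp only [uncleHeight, blockHeight] at hlt hfirst hd
    refine ⟨fun l hjl hli => ?_, ⟨hb, fun k' hk' => ?_⟩, by omega⟩
    · by_contra hs
      -- In cycle `j` itself the block of index 0 has the uncle's own height, so a positive index is
      -- needed there. Both variants of SHH have an honest block at index 1; H creates no uncle.
      have key : ∃ k', IsHonestBlock c l k' ∧ (l = j → 0 < k') := by
        rcases Cycle.cases_of_not_isSelfish hs with h | ⟨b, h⟩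
        · refine ⟨0, by simp [IsHonestBlock, h, official_cycleH], ?_⟩
          rintro rfl
          exact absurd (h ▸ hu) not_hasUncle_cycleH
        · refine ⟨1, ?_, fun _ => one_pos⟩
          cases b <;> simp [IsHonestBlock, h, official_cycleSHH_true, official_cycleSHH_false]
      obtain ⟨k', hk', hpos⟩ := key
      have h1 := hk'.blockHeight_le
      have h2 := hmono (by omega : l + 1 ≤ i)
      have h3 : baseHeight c j + 1 < baseHeight c l + k' + 1 := by
        rcases hjl.eq_or_lt with rfl | hjl
        · have := hpos rfl
          omega
        · have := baseHeight_strictMono c hjl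
          omega
      have h4 := hfirst l k' hk' h3
      rw [blockHeight] at h1
      omega
    · have := hfirst i k' hk' (by omega)
      omega
  · rintro ⟨hs, ⟨hb, hfirst⟩, hd⟩
    simp only [CanRefer, uncleHeight, blockHeight]
    refine ⟨(hs j le_rfl hij).hasUncle, hb, by omega, fun i' k' hb' hlt => ?_, by omega⟩
    rcases lt_trichotomy i' i with h | rfl | h
    · rcases lt_or_ge i' j with h' | h'
      · have h1 := hb'.blockHeight_le
        have h2 := hmono (by omega : i' + 1 ≤ j)
        rw [blockHeight] at h1
        omega
      · exact absurd hb' ((hs i' h' h).getElem?_ne k')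
    · have := hfirst k' hb'
      omega
    · have h1 := IsHonestBlock.blockHeight_le hb
      have h2 := hmono (by omega : i + 1 ≤ i')
      rw [blockHeight] at h1
      omega

theorem canRefer_self (hn : 1 ≤ n₁) :
    CanRefer n₁ c j j k ↔ (∃ b, c j = cycleSHH b) ∧ k = 1 := by
  constructor
  · rintro ⟨hu, hb, hlt, hfirst, -⟩
    simp only [uncleHeight, blockHeight] at hlt hfirst
    have hs : ¬ (c j).IsSelfish := fun h => h.getElem?_ne k hb
    rcases Cycle.cases_of_not_isSelfish hs with h | ⟨b, h⟩
    · exact absurd (h ▸ hu) not_hasUncle_cycleH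
    · refine ⟨⟨b, h⟩, ?_⟩
      have := hfirst j 1 (by
        cases b <;> simp [IsHonestBlock, h, official_cycleSHH_true, official_cycleSHH_false])
        (by push_cast; omega)
      omega
  · rintro ⟨⟨b, h⟩, rfl⟩
    have hb : IsHonestBlock c j 1 := by
      cases b <;> simp [IsHonestBlock, h, official_cycleSHH_true, official_cycleSHH_false]
    simp only [CanRefer, uncleHeight, blockHeight]
    refine ⟨h ▸ hasUncle_cycleSHH b, hb, by omega, fun i' k' hb' hlt => ?_, by omega⟩
    omega

theorem refers_self (hn : 1 ≤ n₁) :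
    Refers n₁ c j j k ↔ (∃ b, c j = cycleSHH b) ∧ k = 1 := by
  rw [Refers, canRefer_self hn, and_iff_left]
  have : {j' | j < j' ∧ CanRefer n₁ c j' j k} = ∅ :=
    Set.eq_empty_of_forall_notMem fun j' h => absurd h.2.le (not_le.mpr h.1)
  simp [this]

/-- The more recent candidates for the same block number `i + k - j - 1`, which must be less than 2.
-/
theorem refers_of_lt (hn : 1 ≤ n₁) (hij : j < i) :
    Refers n₁ c j i k ↔ CanRefer n₁ c j i k ∧ i + k ≤ j + 2 := by
  refine and_congr_right fun hcan => ?_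
  obtain ⟨hs, hf, hd⟩ := (canRefer_of_lt hij).mp hcan
  -- All cycles strictly between `j` and `i` compete. Cycle `i` competes exactly when `k = 1`: it is
  -- then SHH with the last block on the selfish one, and its own uncle takes a slot.
  have hset : {j' | j < j' ∧ CanRefer n₁ c j' i k} = (Finset.Ioo j (i + k) : Finset ℤ) := by
    ext j'
    simp only [Set.mem_ofPred_eq, Finset.coe_Ioo, Set.mem_Ioo]
    refine and_congr_right fun hj => ?_
    rcases lt_trichotomy j' i with h | rfl | h
    · refine iff_of_true ((canRefer_of_lt h).mpr ⟨fun l h1 h2 => hs l (by omega) h2, hf, ?_⟩)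
        (by omega)
      have := baseHeight_strictMono c hj
      omega
    · rw [canRefer_self hn]
      rcases firstHonest_iff.mp hf with ⟨rfl, -⟩ | ⟨rfl, h⟩
      · simp
      · simp [h]
    · refine iff_of_false (fun h' => absurd h'.le (not_le.mpr h)) ?_
      rcases firstHonest_iff.mp hf with ⟨rfl, -⟩ | ⟨rfl, -⟩ <;> push_cast <;> omega
  rw [hset, Set.encard_coe_eq_coe_finsetCard, Int.card_Ioo]
  norm_cast
  omega

theorem Refers.le_add_two (hn : 1 ≤ n₁) (h : Refers n₁ c j i k) : j ≤ i ∧ i ≤ j + 2 := by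
  have := h.1.le
  rcases this.eq_or_lt with rfl | hlt
  · omega
  · have := ((refers_of_lt hn hlt).mp h).2
    omega

theorem refers_next (hn : 1 ≤ n₁) : Refers n₁ c j (j + 1) k ↔
    (c j).IsSelfish ∧ (c (j + 1)).FirstHonest k ∧ (c j).len + k ≤ n₁ := by
  rw [refers_of_lt hn (by omega), canRefer_of_lt (by omega), baseHeight_succ]
  constructor
  · rintro ⟨⟨hs, hf, hd⟩, -⟩
    exact ⟨hs j le_rfl (by omega), hf, by omega⟩
  · rintro ⟨hs, hf, hd⟩
    refine ⟨⟨fun l h1 h2 => ?_, hf, by omega⟩, ?_⟩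
    · obtain rfl : l = j := by omega
      exact hs
    · rcases firstHonest_iff.mp hf with ⟨rfl, -⟩ | ⟨rfl, -⟩ <;> push_cast <;> omega

/-- The case `k = 1` disappears: the uncles of cycles `j + 1` and `j + 2` would fill both slots. -/
theorem refers_next_next (hn : 1 ≤ n₁) : Refers n₁ c j (j + 2) k ↔
    (c j).IsSelfish ∧ (c (j + 1)).IsSelfish ∧ (k = 0 ∧ (c (j + 2)).StartsHonest) ∧
      (c j).len + (c (j + 1)).len ≤ n₁ := by
  have hb : baseHeight c (j + 2) = baseHeight c j + (c j).len + (c (j + 1)).len := by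
    rw [← baseHeight_succ, ← baseHeight_succ]; ring_nf
  rw [refers_of_lt hn (by omega), canRefer_of_lt (by omega), hb, firstHonest_iff]
  constructor
  · rintro ⟨⟨hs, hf, hd⟩, hk⟩
    obtain rfl : k = 0 := by omega
    refine ⟨hs j le_rfl (by omega), hs (j + 1) (by omega) (by omega), ?_, by omega⟩
    simpa using hf
  · rintro ⟨hs, hs', ⟨rfl, hf⟩, hd⟩
    refine ⟨⟨fun l h1 h2 => ?_, Or.inl ⟨rfl, hf⟩, by push_cast; omega⟩, by simp⟩
    obtain rfl | rfl : l = j ∨ l = j + 1 := by omega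
    exacts [hs, hs']

theorem exists_refers_iff (hn : 1 ≤ n₁) : (∃ i k, Refers n₁ c j i k) ↔
    (∃ b, c j = cycleSHH b) ∨
    ((c j).IsSelfish ∧ (c j).len ≤ n₁ ∧ (c (j + 1)).StartsHonest) ∨
    ((c j).IsSelfish ∧ (c j).len + 1 ≤ n₁ ∧ c (j + 1) = cycleSHH true) ∨
    ((c j).IsSelfish ∧ (c (j + 1)).IsSelfish ∧ (c j).len + (c (j + 1)).len ≤ n₁ ∧
      (c (j + 2)).StartsHonest) := by
  constructor
  · rintro ⟨i, k, h⟩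
    have := h.le_add_two hn
    obtain rfl | rfl | rfl : i = j ∨ i = j + 1 ∨ i = j + 2 := by omega
    · exact Or.inl ((refers_self hn).mp h).1
    · obtain ⟨hs, hf, hd⟩ := (refers_next hn).mp h
      rcases firstHonest_iff.mp hf with ⟨rfl, hf⟩ | ⟨rfl, hf⟩ <;> tauto
    · have := (refers_next_next hn).mp h
      tauto
  · rintro (h | ⟨hs, hd, hf⟩ | ⟨hs, hd, hf⟩ | ⟨hs, hs', hd, hf⟩)
    · exact ⟨j, 1, (refers_self hn).mpr ⟨h, rfl⟩⟩
    · exact ⟨j + 1, 0, (refers_next hn).mpr ⟨hs, firstHonest_iff.mpr (by tauto), by omega⟩⟩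
    · exact ⟨j + 1, 1, (refers_next hn).mpr ⟨hs, firstHonest_iff.mpr (by tauto), by omega⟩⟩
    · exact ⟨j + 2, 0, (refers_next_next hn).mpr ⟨hs, hs', ⟨rfl, hf⟩, hd⟩⟩

open Classical in
theorem U_eq_ite (n₁ : ℕ) (c : ℤ → Cycle) (j : ℤ) :
    U n₁ c j = if ∃ i k, Refers n₁ c j i k then 1 else 0 := by
  unfold U
  split_ifs with h
  · rw [show {l | l = j ∧ ∃ i k, Refers n₁ c l i k} = {j} by ext l; simp; grind]
    simp
  · rw [show {l | l = j ∧ ∃ i k, Refers n₁ c l i k} = ∅ by ext l; simp; grind]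
    simp

open Classical in
theorem U'_eq_of_eq_cycleH (hn : 1 ≤ n₁) (h : c j = cycleH) :
    U' n₁ c j = (if (c (j - 1)).IsSelfish ∧ (c (j - 1)).len ≤ n₁ then 1 else 0) +
      if (c (j - 2)).IsSelfish ∧ (c (j - 1)).IsSelfish ∧
        (c (j - 2)).len + (c (j - 1)).len ≤ n₁ then 1 else 0 := by
  have hne (b) : c j ≠ cycleSHH b := fun h' => by
    simpa [cycleH, cycleSHH] using congrArg Cycle.word (h.symm.trans h')
  have hst : (c j).StartsHonest := Or.inl h
  have h1 : (∃ k, Refers n₁ c (j - 1) j k) ↔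
      (c (j - 1)).IsSelfish ∧ (c (j - 1)).len ≤ n₁ := by
    have := fun k => refers_next (c := c) (j := j - 1) (k := k) hn
    simp only [sub_add_cancel, firstHonest_iff, hne, hst] at this
    simp [this]
  have h2 : (∃ k, Refers n₁ c (j - 2) j k) ↔ (c (j - 2)).IsSelfish ∧ (c (j - 1)).IsSelfish ∧
      (c (j - 2)).len + (c (j - 1)).len ≤ n₁ := by
    have := fun k => refers_next_next (c := c) (j := j - 2) (k := k) hn
    rw [show j - 2 + 1 = j - 1 by ring, show j - 2 + 2 = j by ring] at this
    simp [this, hst]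
  have hset : {l | ∃ k, Refers n₁ c l j k} =
      (((if ∃ k, Refers n₁ c (j - 1) j k then {j - 1} else ∅) ∪
        (if ∃ k, Refers n₁ c (j - 2) j k then {j - 2} else ∅) : Finset ℤ) : Set ℤ) := by
    ext l
    have hl : (∃ k, Refers n₁ c l j k) → l = j - 1 ∨ l = j - 2 := by
      rintro ⟨k, hk⟩
      have := hk.le_add_two hn
      have : l ≠ j := by
        rintro rfl
        obtain ⟨⟨b, hb⟩, -⟩ := (refers_self hn).mp hk
        exact hne b hb
      omega
    simp only [Set.mem_ofPred_eq, Finset.coe_union, Set.mem_union, Finset.mem_coe]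
    constructor
    · intro h
      rcases hl h with rfl | rfl <;> simp [h]
    · rintro (h | h) <;> split_ifs at h with h' <;> simp at h <;> exact h ▸ h'
  rw [U', hset, Set.ncard_coe_finset, Finset.card_union_of_disjoint]
  · simp only [h1, h2]
    congr 1 <;> split_ifs <;> rfl
  · split_ifs <;> simp

end Refers

/-! ### Partial sums of `piSeq` and the closed forms -/

section Series

variable (p q : ℝ)

theorem piSeq_of_lt_two {k : ℕ} (hk : k < 2) : piSeq p q k = 0 := if_neg (by omega)

theorem sum_piSeq_add_three (n : ℕ) :
    ∑ k ∈ Finset.range (n + 3), piSeq p q k =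
      p * q ^ 2 + p * q ^ 2 * catalanSum n (p * q) := by
  rw [Finset.sum_range_succ', Finset.sum_range_succ', piSeq_of_lt_two _ _ (by omega : 0 < 2),
    piSeq_of_lt_two _ _ (by omega : 0 + 1 < 2)]
  have h (k : ℕ) : piSeq p q (k + 1 + 1) = (if k = 0 then p * q ^ 2 else 0) +
      p * q ^ 2 * ((catalan k : ℝ) * (p * q) ^ k) := by
    simp only [piSeq, show k + 1 + 1 = k + 2 from rfl, Nat.add_sub_cancel]
    rw [if_pos (by omega)]
    rcases eq_or_ne k 0 with rfl | hk
    · simp; ring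
    · have : ¬ k + 2 = 2 := by omega
      simp only [this, hk, if_false]
      ring
  simp only [h, Finset.sum_add_distrib, ← Finset.mul_sum, catalanSum]
  simp

theorem probTwo_eq (n : ℕ) : probTwo n p q = ∑ i ∈ Finset.range (n + 1),
    piSeq p q i * ∑ j ∈ Finset.range (n - i + 1), piSeq p q j := by
  rw [probTwo, Finset.sum_filter, Finset.sum_product]
  refine Finset.sum_congr rfl fun i hi => ?_
  rw [← Finset.sum_filter, Finset.mul_sum]
  refine Finset.sum_congr ?_ fun _ _ => rfl
  ext j
  simp at hi ⊢
  omega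

/-- The right side is P(A) of the overview and `probTwo` is P(B); each summand of `probOne` is
`piSeq p q i` times the complement of an inner partial sum. -/
theorem probOne_add_probTwo {n : ℕ} (hn : 3 ≤ n) :
    probOne n p q + probTwo n p q = ∑ i ∈ Finset.range (n + 1), piSeq p q i := by
  obtain ⟨N, rfl⟩ := Nat.exists_eq_add_of_le' hn
  have hsplit (f : ℕ → ℝ) (h0 : f 0 = 0) (h1 : f 1 = 0) : ∑ i ∈ Finset.range (N + 3 + 1), f i =
      ∑ i ∈ Finset.Icc 2 (N + 1), f i + f (N + 2) + f (N + 3) := by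
    rw [Finset.sum_range_succ, Finset.sum_range_succ]
    congr 2
    symm
    refine Finset.sum_subset (fun i hi => ?_) fun i hi hi' => ?_
    · simp at hi ⊢
      omega
    · simp at hi hi'
      obtain rfl | rfl : i = 0 ∨ i = 1 := by omega
      exacts [h0, h1]
  have h0 := piSeq_of_lt_two p q (by omega : 0 < 2)
  have h1 := piSeq_of_lt_two p q (by omega : 1 < 2)
  rw [probTwo_eq, hsplit _ h0 h1, hsplit _ (by simp [h0]) (by simp [h1]), probOne]
  -- For `i ≤ n - 2` the inner sum reaches index 2 and has the Catalan form. For `i = n - 1` and `i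
  -- = n` only indices 0 and 1 remain, so it vanishes.
  have hinner : ∀ i ∈ Finset.Icc 2 (N + 1),
      piSeq p q i * ∑ j ∈ Finset.range (N + 3 - i + 1), piSeq p q j =
      piSeq p q i - (1 - p * q ^ 2 - p * q ^ 2 * catalanSum (N + 3 - 2 - i) (p * q)) *
        piSeq p q i := by
    intro i hi
    rw [Finset.mem_Icc] at hi
    rw [show N + 3 - i + 1 = N + 3 - 2 - i + 3 by omega, sum_piSeq_add_three]
    ring
  rw [Finset.sum_congr rfl hinner, Finset.sum_sub_distrib]
  simp [Finset.sum_range_succ, h0, h1]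
  ring

theorem meanH_eq {n : ℕ} (hn : 3 ≤ n) :
    meanH n p q = ∑ i ∈ Finset.range (n + 1), piSeq p q i + probTwo n p q := by
  rw [meanH, ← probOne_add_probTwo p q hn]
  ring

end Series

/-! ### Independence and probabilities of the events -/

/-- The cycles with at most `n` official blocks, all selfish. -/
def selfishOfLenLE (n : ℕ) : Set Cycle := {c | c.IsSelfish ∧ c.len ≤ n}

section Independence

theorem measurableSet_cycle (A : Set Cycle) : MeasurableSet A := MeasurableSpace.measurableSet_top

variable {Ω : Type*} [MeasurableSpace Ω] {μ : Measure Ω} {W : ℤ → Ω → Cycle}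

theorem measureReal_inter_preimage (hindep : iIndepFun W μ) {i j : ℤ} (hij : i ≠ j)
    (A B : Set Cycle) :
    μ.real (W i ⁻¹' A ∩ W j ⁻¹' B) = μ.real (W i ⁻¹' A) * μ.real (W j ⁻¹' B) := by
  simp only [measureReal_def]
  rw [(hindep.indepFun hij).measure_inter_preimage_eq_mul _ _ (measurableSet_cycle _)
    (measurableSet_cycle _), ENNReal.toReal_mul]

theorem measureReal_inter_inter_preimage (hindep : iIndepFun W μ) {i j k : ℤ} (hij : i ≠ j)
    (hik : i ≠ k) (hjk : j ≠ k) (A B C : Set Cycle) :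
    μ.real (W i ⁻¹' A ∩ W j ⁻¹' B ∩ W k ⁻¹' C) =
      μ.real (W i ⁻¹' A) * μ.real (W j ⁻¹' B) * μ.real (W k ⁻¹' C) := by
  have h := hindep.measure_inter_preimage_eq_mul {i, j, k}
    (sets := fun l => if l = i then A else if l = j then B else C)
    (fun _ _ => measurableSet_cycle _)
  simp only [Finset.mem_insert, Finset.mem_singleton, Set.iInter_iInter_eq_or_left,
    Set.iInter_iInter_eq_left] at h
  rw [Finset.prod_insert (by simp [hij, hik]), Finset.prod_insert (by simp [hjk]),
    Finset.prod_singleton] at h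
  simp only [if_true, hij.symm, hik.symm, hjk.symm, if_false] at h
  rw [Set.inter_assoc, measureReal_def, h, ENNReal.toReal_mul, ENNReal.toReal_mul, mul_assoc]
  rfl

end Independence

section Probability

variable {Ω : Type*} [MeasurableSpace Ω] {μ : Measure Ω} [IsProbabilityMeasure μ]
  {p q γ : ℝ}

theorem measureReal_preimage_selfishOfLenLE {X : Ω → Cycle} (hX : Measurable X)
    (hlaw : ∀ c, μ.real {x | X x = c} = c.weight p q γ) (n : ℕ) :
    μ.real (X ⁻¹' selfishOfLenLE n) = ∑ k ∈ Finset.range (n + 1), piSeq p q k := by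
  rw [show X ⁻¹' selfishOfLenLE n = ⋃ k ∈ Finset.range (n + 1), X ⁻¹' selfishOfLen k by
    ext x; simp [selfishOfLenLE, selfishOfLen, and_comm],
    measureReal_biUnion_finset]
  · simp only [measureReal_preimage_selfishOfLen hX hlaw]
  · intro k _ l _ hkl
    exact Set.disjoint_left.mpr fun x hx hx' => hkl (hx.2.symm.trans hx'.2)
  · exact fun k _ => hX (measurableSet_cycle _)

theorem measureReal_preimage_startsHonest {X : Ω → Cycle} (hX : Measurable X)
    (hlaw : ∀ c, μ.real {x | X x = c} = c.weight p q γ) :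
    μ.real (X ⁻¹' {c | c.StartsHonest}) = p + (1 - γ) * p ^ 2 * q := by
  have h (c : Cycle) : μ.real (X ⁻¹' {c}) = c.weight p q γ := hlaw c
  rw [show X ⁻¹' {c | c.StartsHonest} = X ⁻¹' {cycleH} ∪ X ⁻¹' {cycleSHH false} from rfl,
    measureReal_union _ (hX (measurableSet_cycle _)), h, h, weight_cycleH, weight_cycleSHH]
  · simp; ring
  · refine Set.disjoint_left.mpr fun x hx hx' => ?_
    simpa [cycleH, cycleSHH] using congrArg Cycle.word (hx.symm.trans hx')

theorem measureReal_preimage_SHH {X : Ω → Cycle} (hX : Measurable X)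
    (hlaw : ∀ c, μ.real {x | X x = c} = c.weight p q γ) :
    μ.real (X ⁻¹' {c | ∃ b, c = cycleSHH b}) = p ^ 2 * q := by
  have h (c : Cycle) : μ.real (X ⁻¹' {c}) = c.weight p q γ := hlaw c
  rw [show X ⁻¹' {c | ∃ b, c = cycleSHH b} = X ⁻¹' {cycleSHH true} ∪ X ⁻¹' {cycleSHH false} by
      ext x; simp [or_comm],
    measureReal_union _ (hX (measurableSet_cycle _)), h, h, weight_cycleSHH, weight_cycleSHH]
  · simp; ring
  · refine Set.disjoint_left.mpr fun x hx hx' => ?_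
    simpa [cycleSHH] using congrArg Cycle.onSelfish (hx.symm.trans hx')

variable {W : ℤ → Ω → Cycle}

/-- The third cycle serves two purposes: conditioning on H after the pair, and an honest start after
the pair. -/
theorem measureReal_selfish_pair (hmeas : ∀ i, Measurable (W i)) (hindep : iIndepFun W μ)
    (hlaw : ∀ i c, μ.real {x | W i x = c} = c.weight p q γ)
    {i j k : ℤ} (hij : i ≠ j) (hik : i ≠ k) (hjk : j ≠ k) (n : ℕ) (C : Set Cycle) :
    μ.real ({x | (W i x).IsSelfish ∧ (W j x).IsSelfish ∧ (W i x).len + (W j x).len ≤ n} ∩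
      W k ⁻¹' C) = probTwo n p q * μ.real (W k ⁻¹' C) := by
  rw [show {x | (W i x).IsSelfish ∧ (W j x).IsSelfish ∧ (W i x).len + (W j x).len ≤ n} ∩
      W k ⁻¹' C = ⋃ ab ∈ {ab ∈ Finset.range (n + 1) ×ˢ Finset.range (n + 1) | ab.1 + ab.2 ≤ n},
        W i ⁻¹' selfishOfLen ab.1 ∩ W j ⁻¹' selfishOfLen ab.2 ∩ W k ⁻¹' C by
    ext x
    simp only [Set.mem_inter_iff, Set.mem_ofPred_eq, Set.mem_preimage, Finset.mem_filter,
      Finset.mem_product, Finset.mem_range, Set.mem_iUnion, selfishOfLen, exists_prop]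
    constructor
    · rintro ⟨⟨h1, h2, h3⟩, h4⟩
      exact ⟨(_, _), ⟨⟨Nat.lt_succ_of_le ((Nat.le_add_right _ _).trans h3),
        Nat.lt_succ_of_le ((Nat.le_add_left _ _).trans h3)⟩, h3⟩, ⟨⟨h1, rfl⟩, h2, rfl⟩, h4⟩
    · rintro ⟨ab, ⟨-, hab⟩, ⟨⟨h1, h2⟩, h3, h4⟩, h5⟩
      exact ⟨⟨h1, h3, by omega⟩, h5⟩,
    measureReal_biUnion_finset, probTwo, Finset.sum_mul]
  · refine Finset.sum_congr rfl fun ab _ => ?_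
    rw [measureReal_inter_inter_preimage hindep hij hik hjk,
      measureReal_preimage_selfishOfLen (hmeas i) (hlaw i),
      measureReal_preimage_selfishOfLen (hmeas j) (hlaw j)]
  · rintro ⟨a, b⟩ - ⟨a', b'⟩ - hne
    refine Set.disjoint_left.mpr fun x hx hx' => hne ?_
    exact Prod.ext (hx.1.1.2.symm.trans hx'.1.1.2) (hx.1.2.2.symm.trans hx'.1.2.2)
  · exact fun ab _ => ((hmeas i (measurableSet_cycle _)).inter
      (hmeas j (measurableSet_cycle _))).inter (hmeas k (measurableSet_cycle _))

/-- The uncle of cycle `m` is referred. -/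
theorem measureReal_exists_refers (hmeas : ∀ i, Measurable (W i)) (hindep : iIndepFun W μ)
    (hlaw : ∀ i c, μ.real {x | W i x = c} = c.weight p q γ) {n₁ : ℕ} (hn : 3 ≤ n₁) (m : ℤ) :
    MeasurableSet {x | ∃ i k, Refers n₁ (fun i => W i x) m i k} ∧
    μ.real {x | ∃ i k, Refers n₁ (fun i => W i x) m i k} =
      (p + (1 - γ) * p ^ 2 * q) * meanH n₁ p q +
        γ * p ^ 2 * q * (p * q ^ 2 + p * q ^ 2 * catalanSum (n₁ - 3) (p * q)) + p ^ 2 * q := by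
  have hM (i : ℤ) (A : Set Cycle) : MeasurableSet (W i ⁻¹' A) := hmeas i (measurableSet_cycle A)
  have hpair : MeasurableSet {x | (W m x).IsSelfish ∧ (W (m + 1) x).IsSelfish ∧
      (W m x).len + (W (m + 1) x).len ≤ n₁} := by
    have hlen (i : ℤ) : Measurable fun x => (W i x).len :=
      (measurable_from_top (f := Cycle.len)).comp (hmeas i)
    exact (hM m {c | c.IsSelfish}).inter ((hM (m + 1) {c | c.IsSelfish}).inter
      (measurableSet_le ((hlen m).add (hlen (m + 1))) measurable_const))
  -- The bound drops to `n₁ - 1` before SHH with the last block on the selfish one, whose honest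
  -- block sits one height further.
  have hE : {x | ∃ i k, Refers n₁ (fun i => W i x) m i k} =
      W m ⁻¹' {c | ∃ b, c = cycleSHH b} ∪
      (W m ⁻¹' selfishOfLenLE n₁ ∩ W (m + 1) ⁻¹' {c | c.StartsHonest} ∪
      (W m ⁻¹' selfishOfLenLE (n₁ - 1) ∩ W (m + 1) ⁻¹' {cycleSHH true} ∪
      {x | (W m x).IsSelfish ∧ (W (m + 1) x).IsSelfish ∧
        (W m x).len + (W (m + 1) x).len ≤ n₁} ∩ W (m + 2) ⁻¹' {c | c.StartsHonest})) := by
    ext x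
    have h1 : (W m x).len ≤ n₁ - 1 ↔ (W m x).len + 1 ≤ n₁ := by omega
    simp only [Set.mem_ofPred_eq, exists_refers_iff (show 1 ≤ n₁ by omega), Set.mem_union,
      Set.mem_inter_iff, Set.mem_preimage, selfishOfLenLE, h1, Set.mem_singleton_iff, and_assoc]
  have hns (b) : ¬ (cycleSHH b).IsSelfish := by
    cases b <;> simp [Cycle.IsSelfish, official_cycleSHH_true, official_cycleSHH_false]
  have hns' {c : Cycle} (h : c.StartsHonest) : ¬ c.IsSelfish := by
    rcases h with rfl | rfl
    · simp [Cycle.IsSelfish, official_cycleH]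
    · exact hns _
  have hst : ¬ (cycleSHH true).StartsHonest := by
    rintro (h | h)
    · simpa [cycleH, cycleSHH] using congrArg Cycle.word h
    · simpa [cycleSHH] using congrArg Cycle.onSelfish h
  have h2 := (hM m (selfishOfLenLE n₁)).inter (hM (m + 1) {c | c.StartsHonest})
  have h3 := (hM m (selfishOfLenLE (n₁ - 1))).inter (hM (m + 1) {cycleSHH true})
  have h4 := hpair.inter (hM (m + 2) {c | c.StartsHonest})
  rw [hE]
  refine ⟨(hM _ _).union (h2.union (h3.union h4)), ?_⟩
  rw [measureReal_union _ (h2.union (h3.union h4)), measureReal_union _ (h3.union h4),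
    measureReal_union _ h4,
    measureReal_selfish_pair hmeas hindep hlaw (by omega) (by omega) (by omega),
    measureReal_inter_preimage hindep (by omega), measureReal_inter_preimage hindep (by omega),
    measureReal_preimage_startsHonest (hmeas _) (hlaw _),
    measureReal_preimage_startsHonest (hmeas _) (hlaw _),
    measureReal_preimage_SHH (hmeas _) (hlaw _),
    measureReal_preimage_selfishOfLenLE (hmeas _) (hlaw _),
    measureReal_preimage_selfishOfLenLE (hmeas _) (hlaw _),
    show μ.real (W (m + 1) ⁻¹' {cycleSHH true}) = _ from hlaw _ _, weight_cycleSHH,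
    meanH_eq p q hn, show n₁ - 1 + 1 = n₁ - 3 + 3 by omega, sum_piSeq_add_three]
  · simp; ring
  · exact Set.disjoint_left.mpr fun x hx hx' => hns true (hx.2 ▸ hx'.1.2.1)
  · refine Set.disjoint_left.mpr fun x hx hx' => ?_
    rcases hx' with h | h
    · exact hst (h.2 ▸ hx.2)
    · exact hns' hx.2 h.1.2.1
  · refine Set.disjoint_left.mpr fun x ⟨b, hb⟩ hx' => hns b (hb ▸ ?_)
    rcases hx' with h | h | h
    exacts [h.1.1, h.1.1, h.1.1]

end Probability

/-! ### Assembly of the two statements -/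

theorem eq_cycleH_iff {c : Cycle} : c = cycleH ↔ c.word = [H] := by
  refine ⟨by rintro rfl; rfl, fun h => Cycle.ext_word h (Bool.eq_false_iff.mpr fun h' => ?_)⟩
  simp [c.eq_of_onSelfish h'] at h

end BrutalFork

theorem mainTheorem11 {Ω : Type*} [MeasurableSpace Ω] (μ : Measure Ω) [IsProbabilityMeasure μ]
    (p q γ : ℝ) (hpq : p + q = 1) (hq0 : 0 ≤ q) (hq : q ≤ 1 / 2) (hγ0 : 0 ≤ γ) (hγ1 : γ ≤ 1)
    (n₁ : ℕ) (hn : 3 ≤ n₁)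
    (W : ℤ → Ω → Cycle) (hmeas : ∀ i, Measurable (W i)) (hindep : iIndepFun W μ)
    (hlaw : ∀ i c, μ.real {x | W i x = c} = c.weight p q γ)
    (m : ℤ) (ν : Measure Ω) (hν : ν = ProbabilityTheory.cond μ {x | (W m x).word = [Miner.H]}) :
    (ν.real {x | U' n₁ (fun i => W i x) m = 1} = probOne n₁ p q ∧
      ν.real {x | U' n₁ (fun i => W i x) m = 2} = probTwo n₁ p q ∧
      ν.real {x | 3 ≤ U' n₁ (fun i => W i x) m} = 0 ∧
      Integrable (fun x => (U' n₁ (fun i => W i x) m : ℝ)) ν ∧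
      ∫ x, (U' n₁ (fun i => W i x) m : ℝ) ∂ν = meanH n₁ p q) ∧
    Integrable (fun x => (U n₁ (fun i => W i x) m : ℝ)) μ ∧
    ∫ x, (U n₁ (fun i => W i x) m : ℝ) ∂μ =
      (p + (1 - γ) * p ^ 2 * q) * meanH n₁ p q +
        γ * p ^ 2 * q * (p * q ^ 2 + p * q ^ 2 * catalanSum (n₁ - 3) (p * q)) +
        p ^ 2 * q := by
  classical
  refine ⟨?_, ?_⟩
  · have hM (i : ℤ) (A : Set Cycle) : MeasurableSet (W i ⁻¹' A) :=
      hmeas i (measurableSet_cycle A)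
    have hHs : {x | (W m x).word = [Miner.H]} = W m ⁻¹' {cycleH} := by
      ext x
      simp [eq_cycleH_iff]
    have hPH : μ.real (W m ⁻¹' {cycleH}) = p := (hlaw m cycleH).trans (weight_cycleH p q γ)
    -- From `q ≤ 1 / 2` comes `p ≥ 1 / 2`, so the conditioning event has positive probability.
    have hp : p ≠ 0 := by linarith
    rw [hHs] at hν
    have hνp : IsProbabilityMeasure ν := by
      rw [hν]
      refine cond_isProbabilityMeasure fun h0 => hp ?_
      rw [← hPH, measureReal_def, h0, ENNReal.toReal_zero]
    have hνr (X : Set Ω) : ν.real X = p⁻¹ * μ.real (X ∩ W m ⁻¹' {cycleH}) := by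
      rw [hν, measureReal_def, cond_apply (hM _ _), ENNReal.toReal_mul, ENNReal.toReal_inv,
        ← measureReal_def, hPH, Set.inter_comm, measureReal_def]
    have hνH : ∀ᵐ x ∂ν, W m x = cycleH := by
      rw [hν]
      exact ae_cond_mem (hM m {cycleH})
    set A : Set Ω := W (m - 1) ⁻¹' selfishOfLenLE n₁ with hA
    set B : Set Ω := {x | (W (m - 2) x).IsSelfish ∧ (W (m - 1) x).IsSelfish ∧
      (W (m - 2) x).len + (W (m - 1) x).len ≤ n₁} with hB
    have hBA : B ⊆ A := fun x hx => ⟨hx.2.1, by have := hx.2.2; omega⟩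
    have hmA : MeasurableSet A := hM _ _
    have hmB : MeasurableSet B := by
      have hlen (i : ℤ) : Measurable fun x => (W i x).len :=
        (measurable_from_top (f := Cycle.len)).comp (hmeas i)
      exact (hM (m - 2) {c | c.IsSelfish}).inter ((hM (m - 1) {c | c.IsSelfish}).inter
        (measurableSet_le ((hlen (m - 2)).add (hlen (m - 1))) measurable_const))
    have hU : ∀ᵐ x ∂ν, U' n₁ (fun i => W i x) m =
        (if x ∈ A then 1 else 0) + if x ∈ B then 1 else 0 := by
      filter_upwards [hνH] with x hx
      convert U'_eq_of_eq_cycleH (c := fun i => W i x) (show 1 ≤ n₁ by omega) hx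
      all_goals exact Iff.rfl
    -- A and B involve only cycles before `m`, so conditioning on cycle `m` leaves their
    -- probabilities unchanged.
    have hνA : ν.real A = ∑ i ∈ Finset.range (n₁ + 1), piSeq p q i := by
      rw [hνr, hA, measureReal_inter_preimage hindep (by omega), hPH,
        measureReal_preimage_selfishOfLenLE (hmeas _) (hlaw _)]
      field_simp
    have hνB : ν.real B = probTwo n₁ p q := by
      rw [hνr, hB, measureReal_selfish_pair hmeas hindep hlaw (by omega) (by omega) (by omega),
        hPH]
      field_simp
    have hUr : (fun x => (U' n₁ (fun i => W i x) m : ℝ)) =ᵐ[ν]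
        fun x => A.indicator 1 x + B.indicator 1 x := by
      filter_upwards [hU] with x hx
      rw [hx]
      simp [Set.indicator_apply]
    have hiA : Integrable (A.indicator (1 : Ω → ℝ)) ν :=
      (integrable_const (1 : ℝ)).indicator hmA
    have hiB : Integrable (B.indicator (1 : Ω → ℝ)) ν :=
      (integrable_const (1 : ℝ)).indicator hmB
    refine ⟨?_, ?_, ?_, (hiA.add hiB).congr hUr.symm, ?_⟩
    -- Since B ⊆ A, the value 1 is taken exactly on A \ B.
    · rw [← add_sub_cancel_right (probOne n₁ p q) (probTwo n₁ p q), probOne_add_probTwo p q hn,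
        ← hνA, ← hνB, ← measureReal_sdiff hBA hmB]
      refine measureReal_congr ?_
      filter_upwards [hU] with x hx
      refine propext ?_
      change U' n₁ (fun i => W i x) m = 1 ↔ x ∈ A ∧ x ∉ B
      rw [hx]
      have := @hBA x
      split_ifs <;> simp_all
    · rw [← hνB]
      refine measureReal_congr ?_
      filter_upwards [hU] with x hx
      refine propext ?_
      change U' n₁ (fun i => W i x) m = 2 ↔ x ∈ B
      rw [hx]
      have := @hBA x
      split_ifs <;> simp_all
    · rw [← measureReal_empty (μ := ν)]
      refine measureReal_congr ?_
      filter_upwards [hU] with x hx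
      refine propext ?_
      change 3 ≤ U' n₁ (fun i => W i x) m ↔ False
      rw [hx]
      split_ifs <;> simp
    · rw [integral_congr_ae hUr, integral_add hiA hiB, integral_indicator_one hmA,
        integral_indicator_one hmB, hνA, hνB, meanH_eq p q hn]
  · obtain ⟨hE, hPE⟩ := measureReal_exists_refers hmeas hindep hlaw hn m
    set E : Set Ω := {x | ∃ i k, Refers n₁ (fun i => W i x) m i k}
    -- A cycle creates at most one uncle, so `U` is an indicator.
    have hU : (fun x => (U n₁ (fun i => W i x) m : ℝ)) = E.indicator 1 := by
      funext x
      rw [U_eq_ite, Set.indicator_apply]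
      change ((if x ∈ E then 1 else 0 : ℕ) : ℝ) = _
      split_ifs <;> simp
    rw [hU, integral_indicator_one hE, hPE]
    exact ⟨(integrable_const (1 : ℝ)).indicator hE, rfl⟩
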